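/- Let $M_2$ be the algebra of complex $2\times2$ matrices, $D=\begin{pmatrix}0&0\\1&0\end{pmatrix}$, and let $\eta,\nu,\xi\in\mathbb R$, $\zeta\in\mathbb C$ satisfy $\eta>0$, $\nu\ge 0$, $|\zeta|^2\le\nu(\nu+\eta)$. Define $\tilde{\mathcal L}_*:M_2\to M_2$ by $$\begin{aligned}\tilde{\mathcal L}_*(\rho)={}&i\xi[DD^\dagger-D^\dagger D,\rho]-\tfrac{\nu+\eta}{2}(D^\dagger D\rho-2D\rho D^\dagger+\rho D^\dagger D)\\&-\tfrac{\nu}{2}(DD^\dagger\rho-2D^\dagger\rho D+\rho DD^\dagger)+\overline{\zeta}\,D\rho D+\zeta\,D^\dagger\rho D^\dagger,\end{aligned}$$ let $\tilde{\mathcal T}_{*t}=e^{t\tilde{\mathcal L}_*}$ $(t\ge 0)$, let $\mathcal T_t$ be its dual, $\operatorname{tr}(\rho\,\mathcal T_t(x))=\operatorname{tr}(\tilde{\mathcal T}_{*t}(\rho)\,x)$, and put $\mathcal T_{*t}(\omega)=\omega\circ\mathcal T_t$ (this is the two-level quantum Markov semigroup arising in the weak coupling limit with a squeezed-vacuum reservoir).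 Write $\omega_\rho(x)=\operatorname{tr}(\rho x)$, $\sigma_3=\operatorname{diag}(1,-1)$ and $\rho_\infty=\frac12\bigl(I-\frac{\eta}{2\nu+\eta}\sigma_3\bigr)$. Let $P$ be the pure state space of $M_2$ with the weak$^*$ topology. An orthogonal measure representing a state $\omega_\rho$ means a measure $\sum_{i=1}^2a_i\,\delta_{\omega_{|e_i\rangle\langle e_i|}}$ on $P$, where $\rho=\sum_{i=1}^2a_i|e_i\rangle\langle e_i|$ is a diagonalization of $\rho$ in an orthonormal basis $(e_1,e_2)$, with $a_i\ge 0$. A net $(\mu_t)_{t\ge0}$ of Borel probability measures on $P$ satisfies a large deviation principle with powers $(1/t)$ and rate function $J:P\to[0,\infty]$ if $J$ is lower semicontinuous and, as $t\to\infty$, $\limsup\mu_t(F)^{1/t}\le\sup_{F}e^{-J}$ for every closed $F\subset P$ and $\liminf\mu_t(G)^{1/t}\ge\sup_{G}e^{-J}$ for every open $G\subset P$ (with $\sup_\emptyset=0$). Assume $\nu=0$, and let $\omega$ be a state on $M_2$ with $\omega\ne\omega_{\rho_\infty}$. Then: (a) For every $t\ge0$ there is an orthogonal measure representing $\mathcal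 T_{*t}(\omega)$, and every net $(\mu_t)_{t\ge0}$ of orthogonal measures $\mu_t$ representing $\mathcal T_{*t}(\omega)$ satisfies a large deviation principle with powers $(1/t)$ and rate function $$J(\omega_{|e\rangle\langle e|})=\begin{cases}0&\text{if }|e\rangle\langle e|=\rho_\infty,\\ \eta&\text{if }|e\rangle\langle e|=I-\rho_\infty,\\ +\infty&\text{otherwise.}\end{cases}$$ (b) For each projection $p\in M_2\setminus\{0\}$, $\omega(\mathcal T_t(p))>0$ for all $t$ large enough, and $$\lim_{t\to\infty}\frac1t\log\omega(\mathcal T_t(p))=\begin{cases}-\eta&\text{if }p=I-\rho_\infty,\\0&\text{otherwise.}\end{cases}$$ -/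

import Mathlib

open Filter Topology MeasureTheory
open scoped ENNReal ComplexOrder Matrix

/-- The full algebra of complex `2 × 2` matrices. -/
abbrev M2 : Type := Matrix (Fin 2) (Fin 2) ℂ

/-! ### States and pure states -/

/-- The states of `M2` (positive normalized functionals), inside the dual with its weak* topology. -/
def stateSpace : Set (WeakDual ℂ M2) :=
  {ω | (∀ x : M2, 0 ≤ ω (xᴴ * x)) ∧ ω 1 = 1}

/-- The pure states are the extreme points of the state space. -/
abbrev PureState : Type := ↥(Set.extremePoints ℝ stateSpace)

noncomputable instance : MeasurableSpace PureState := borel PureState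

instance : BorelSpace PureState := ⟨rfl⟩

/-- The functional `ω_ρ : x ↦ tr (ρ x)`. -/
noncomputable def traceFunctional (ρ : M2) : WeakDual ℂ M2 :=
  StrongDual.toWeakDual (LinearMap.toContinuousLinearMap
    ((Matrix.traceLinearMap (Fin 2) ℂ ℂ).comp (LinearMap.mulLeft ℂ ρ)))

theorem traceFunctional_apply (ρ x : M2) : traceFunctional ρ x = (ρ * x).trace := rfl

/-- The rank-one operator `|e⟩⟨e|`. -/
noncomputable def ketBra (e : EuclideanSpace ℂ (Fin 2)) : M2 :=
  Matrix.of fun i j => e i * star (e j)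

/-- `μ` is an orthogonal measure representing `ω`: for some diagonal form
`ρ = ∑ i, a i • |e i⟩⟨e i|` of the positive operator `ρ` with `ω = ω_ρ`, where `e` is an
orthonormal basis, `μ` is the measure `∑ i, a i • δ_{|e i⟩⟨e i|}` on the pure state space. -/
def IsOrthogonalMeasure (ω : WeakDual ℂ M2) (μ : Measure PureState) : Prop :=
  ∃ (e : OrthonormalBasis (Fin 2) ℂ (EuclideanSpace ℂ (Fin 2))) (a : Fin 2 → ℝ)
    (π : Fin 2 → PureState),
    (∀ i, 0 ≤ a i) ∧
    ω = traceFunctional (∑ i, (a i : ℂ) • ketBra (e i)) ∧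
    (∀ i, (π i : WeakDual ℂ M2) = traceFunctional (ketBra (e i))) ∧
    μ = ∑ i, ENNReal.ofReal (a i) • Measure.dirac (π i)

/-! ### Large deviations -/

/-- The net `(μ t)`, `t ≥ 0`, of Borel probability measures satisfies a large deviation principle
with powers `1/t` (as `t → ∞`) and rate function `J`. -/
structure SatisfiesLDP {X : Type*} [TopologicalSpace X] [MeasurableSpace X] [BorelSpace X]
    (μ : ℝ → Measure X) (J : X → ℝ≥0∞) : Prop where
  prob : ∀ t, 0 ≤ t → IsProbabilityMeasure (μ t)
  lsc : LowerSemicontinuous J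
  upper : ∀ F : Set X, IsClosed F →
    limsup (fun t : ℝ => (μ t F) ^ (1 / t)) atTop ≤ ⨆ x ∈ F, EReal.exp (-(J x : EReal))
  lower : ∀ G : Set X, IsOpen G →
    ⨆ x ∈ G, EReal.exp (-(J x : EReal)) ≤ liminf (fun t : ℝ => (μ t G) ^ (1 / t)) atTop

/-! ### The two-level weak coupling limit semigroup -/

/-- The lowering matrix `D`. -/
def lowerD : M2 := !![0, 0; 1, 0]

/-- The Pauli matrix `σ₃`. -/
def pauli3 : M2 := !![1, 0; 0, -1]

/-- The generator of the predual semigroup, as a function on matrices. -/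
noncomputable def wclGenFun (η ν ξ : ℝ) (ζ : ℂ) (ρ : M2) : M2 :=
  (Complex.I * ξ) • ((lowerD * lowerDᴴ - lowerDᴴ * lowerD) * ρ
      - ρ * (lowerD * lowerDᴴ - lowerDᴴ * lowerD))
    - (((ν : ℂ) + η) / 2) •
      (lowerDᴴ * lowerD * ρ - (2 : ℂ) • (lowerD * ρ * lowerDᴴ) + ρ * (lowerDᴴ * lowerD))
    - ((ν : ℂ) / 2) •
      (lowerD * lowerDᴴ * ρ - (2 : ℂ) • (lowerDᴴ * ρ * lowerD) + ρ * (lowerD * lowerDᴴ))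
    + star ζ • (lowerD * ρ * lowerD) + ζ • (lowerDᴴ * ρ * lowerDᴴ)

/-- The generator of the predual semigroup, as a linear map. -/
noncomputable def wclGen (η ν ξ : ℝ) (ζ : ℂ) : M2 →ₗ[ℂ] M2 where
  toFun := wclGenFun η ν ξ ζ
  map_add' x y := by
    simp only [wclGenFun, mul_add, add_mul, smul_add, smul_sub]
    abel
  map_smul' c x := by
    simp only [wclGenFun, Matrix.mul_smul, Matrix.smul_mul, RingHom.id_apply, smul_add, smul_sub]
    simp only [smul_comm c]

open scoped Matrix.Norms.L2Operator in
/-- The predual semigroup `exp (t L)` acting on matrices; the (operator) norm on `M2` only serves to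
make the continuous endomorphisms of `M2` a normed algebra. -/
noncomputable def wclPredual (η ν ξ : ℝ) (ζ : ℂ) (t : ℝ) : M2 →ₗ[ℂ] M2 :=
  (NormedSpace.exp ((t : ℂ) • LinearMap.toContinuousLinearMap (wclGen η ν ξ ζ)) :
    M2 →L[ℂ] M2)

/-- The dual of a linear map on `M2` for the trace pairing `(ρ, x) ↦ tr (ρ x)`. -/
noncomputable def traceDual (Φ : M2 →ₗ[ℂ] M2) : M2 →ₗ[ℂ] M2 where
  toFun x := Matrix.of fun i j => (Φ (Matrix.single j i 1) * x).trace
  map_add' x y := by ext i j; simp [mul_add]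
  map_smul' c x := by ext i j; simp

theorem trace_traceDual (Φ : M2 →ₗ[ℂ] M2) (ρ x : M2) :
    (ρ * traceDual Φ x).trace = (Φ ρ * x).trace := by
  have h : ρ = ∑ i, ∑ j, ρ i j • Matrix.single i j (1 : ℂ) := by
    conv_lhs => rw [Matrix.matrix_eq_sum_single ρ]
    simp
  conv_rhs => rw [h]
  simp only [map_sum, map_smul, Finset.sum_mul, Matrix.trace_sum, Matrix.smul_mul,
    Matrix.trace_smul]
  simp [Matrix.trace, Matrix.mul_apply, traceDual]

/-- The quantum Markov semigroup `(T_t)` on `M2`. -/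
noncomputable def wclSemigroup (η ν ξ : ℝ) (ζ : ℂ) (t : ℝ) : M2 →ₗ[ℂ] M2 :=
  traceDual (wclPredual η ν ξ ζ t)

/-- The predual semigroup on functionals: `T_{*t}(ω) = ω ∘ T_t`. -/
noncomputable def wclEvolve (η ν ξ : ℝ) (ζ : ℂ) (t : ℝ) (ω : WeakDual ℂ M2) : WeakDual ℂ M2 :=
  StrongDual.toWeakDual ((WeakDual.toStrongDual ω).comp
    (LinearMap.toContinuousLinearMap (wclSemigroup η ν ξ ζ t)))

theorem wclEvolve_apply (η ν ξ : ℝ) (ζ : ℂ) (t : ℝ) (ω : WeakDual ℂ M2) (x : M2) :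
    wclEvolve η ν ξ ζ t ω x = ω (wclSemigroup η ν ξ ζ t x) := rfl

/-- The density matrix `ρ_∞` of the absorbing state. -/
noncomputable def rhoInfty (η ν : ℝ) : M2 :=
  (1 / 2 : ℂ) • (1 - ((η : ℂ) / (2 * ν + η)) • pauli3)

open Classical in
/-- The rate function: `0` at `ρ_∞`, `η` at `I - ρ_∞`, and `∞` at every other pure state. -/
noncomputable def wclRate (η ν : ℝ) (φ : PureState) : ℝ≥0∞ :=
  if (φ : WeakDual ℂ M2) = traceFunctional (rhoInfty η ν) then 0
  else if (φ : WeakDual ℂ M2) = traceFunctional (1 - rhoInfty η ν) then ENNReal.ofReal η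
  else ⊤

/-! ### Density matrices and pure states -/

/-! When `ν = 0` the bound on `ζ` forces `ζ = 0`, and the generator is diagonalized by four explicit
matrices. A density matrix with diagonal `a, 1 - a` and off-diagonal entry `b` then evolves in
closed form (`wclPredual_vacuum`): the upper population is `a E` with `E = exp (-η t)`, the
coherences decay like `exp (-η t / 2)` up to a phase, and the limit is the lower-level projection
`ρ_∞`.

For (a), let `l` be the smaller eigenvalue of the evolved matrix. The trace is 1, so the determinant
is `l (1 - l)`, and it equals `E (a (1 - E a) - |b|²)` (`det_wclPredual_vacuum`). Positivity of the
initial state gives `|b|² ≤ a (1 - a)`, and `a > 0` because that state is not `ρ_∞`; hence `l` is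
trapped between constant multiples of `E`, and `log l / t → -η`. The eigenprojections converge to
`ρ_∞` and `1 - ρ_∞`. Everything else is a general fact about two moving atoms
(`satisfiesLDP_two_point`).

For (b), the expectation of `1 - ρ_∞` is exactly `a E`; any other nonzero projection has a strictly
positive expectation in `ρ_∞`, hence rate 0. -/

theorem traceFunctional_single (ρ : M2) (i j : Fin 2) :
    traceFunctional ρ (Matrix.single j i 1) = ρ i j := by
  rw [traceFunctional_apply]
  simp [Matrix.trace_mul_single]

theorem traceFunctional_injective : Function.Injective traceFunctional := fun ρ σ h => by
  ext i j
  rw [← traceFunctional_single ρ, ← traceFunctional_single σ, h]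

theorem eq_traceFunctional (ω : WeakDual ℂ M2) :
    ω = traceFunctional (Matrix.of fun i j => ω (Matrix.single j i 1)) := by
  refine DFunLike.ext _ _ fun x => ?_
  have hx : x = ∑ i, ∑ j, x i j • Matrix.single i j (1 : ℂ) := by
    conv_lhs => rw [Matrix.matrix_eq_sum_single x]
    simp
  rw [traceFunctional_apply]
  conv_lhs => rw [hx]
  simp only [map_add, map_smul, smul_eq_mul, Matrix.trace, Matrix.diag, Matrix.mul_apply,
    Matrix.of_apply, Fin.sum_univ_two]
  ring

theorem traceFunctional_mem_stateSpace {ρ : M2} (hρ : ρ.PosSemidef) (h1 : ρ.trace = 1) :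
    traceFunctional ρ ∈ stateSpace := by
  refine ⟨fun x => ?_, by rw [traceFunctional_apply, mul_one, h1]⟩
  rw [traceFunctional_apply, ← mul_assoc, Matrix.trace_mul_comm, ← mul_assoc]
  exact (hρ.mul_mul_conjTranspose_same x).trace_nonneg

/-- Polarization: only the vanishing imaginary parts of the quadratic form are used, and four test
vectors suffice. -/
theorem isHermitian_of_forall_nonneg {M : M2}
    (h : ∀ x : Fin 2 → ℂ, 0 ≤ star x ⬝ᵥ M *ᵥ x) : M.IsHermitian := by
  have him := fun x => (Complex.nonneg_iff.1 (h x)).2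
  have h0 := him ![1, 0]
  have h1 := him ![0, 1]
  have h2 := him ![1, 1]
  have h3 := him ![1, Complex.I]
  simp [dotProduct, Matrix.mulVec, Fin.sum_univ_two] at h0 h1 h2 h3
  ext i j
  fin_cases i <;> fin_cases j <;> apply Complex.ext <;> simp <;> linarith

theorem exists_density {ω : WeakDual ℂ M2} (hω : ω ∈ stateSpace) :
    ∃ ρ : M2, ρ.PosSemidef ∧ ρ.trace = 1 ∧ ω = traceFunctional ρ := by
  obtain ⟨ρ, rfl⟩ : ∃ ρ, ω = traceFunctional ρ := ⟨_, eq_traceFunctional ω⟩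
  have key : ∀ x : Fin 2 → ℂ, 0 ≤ star x ⬝ᵥ ρ *ᵥ x := fun x => by
    -- The test element `|e₀⟩⟨x|` has `|x⟩⟨x|` as its square `yᴴ y`, so positivity of the state
    -- becomes positivity of the quadratic form of `ρ`.
    convert hω.1 (Matrix.vecMulVec (Pi.single 0 1) (star x)) using 1
    rw [traceFunctional_apply]
    simp [Matrix.trace, Matrix.mul_apply, Matrix.vecMulVec_apply, dotProduct, Matrix.mulVec,
      Fin.sum_univ_two]
    ring
  refine ⟨ρ, .of_dotProduct_mulVec_nonneg (isHermitian_of_forall_nonneg key) key, ?_, rfl⟩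
  simpa [traceFunctional_apply] using hω.2

theorem ketBra_eq_vecMulVec (e : EuclideanSpace ℂ (Fin 2)) :
    ketBra e = Matrix.vecMulVec e.ofLp (star e.ofLp) := rfl

theorem posSemidef_ketBra (e : EuclideanSpace ℂ (Fin 2)) : (ketBra e).PosSemidef :=
  Matrix.posSemidef_vecMulVec_self_star e.ofLp

theorem dotProduct_star_self_of_norm_eq_one {e : EuclideanSpace ℂ (Fin 2)} (he : ‖e‖ = 1) :
    star e.ofLp ⬝ᵥ e.ofLp = 1 := by
  have := inner_self_eq_norm_sq_to_K (𝕜 := ℂ) e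
  rw [he, EuclideanSpace.inner_eq_star_dotProduct, dotProduct_comm] at this
  simpa using this

theorem trace_ketBra {e : EuclideanSpace ℂ (Fin 2)} (he : ‖e‖ = 1) : (ketBra e).trace = 1 := by
  rw [ketBra_eq_vecMulVec, Matrix.trace_vecMulVec, dotProduct_comm,
    dotProduct_star_self_of_norm_eq_one he]

theorem det_ketBra (e : EuclideanSpace ℂ (Fin 2)) : (ketBra e).det = 0 := by
  simp [Matrix.det_fin_two, ketBra]
  ring

theorem ketBra_mul_ketBra {e : EuclideanSpace ℂ (Fin 2)} (he : ‖e‖ = 1) :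
    ketBra e * ketBra e = ketBra e := by
  rw [ketBra_eq_vecMulVec, Matrix.vecMulVec_mul_vecMulVec,
    dotProduct_star_self_of_norm_eq_one he, one_smul]

open scoped MatrixOrder Matrix.Norms.L2Operator in
theorem Matrix.PosSemidef.exists_eq_conjTranspose_mul_self {n : Type*} [Fintype n] [DecidableEq n]
    {ρ : Matrix n n ℂ} (hρ : ρ.PosSemidef) : ∃ B : Matrix n n ℂ, ρ = Bᴴ * B :=
  CStarAlgebra.nonneg_iff_eq_star_mul_self.1 hρ.nonneg

/-- A density matrix with full weight on a unit vector is the corresponding projection. -/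
theorem eq_ketBra_of_trace_mul {e : EuclideanSpace ℂ (Fin 2)} (he : ‖e‖ = 1) {ρ : M2}
    (hρ : ρ.PosSemidef) (h1 : ρ.trace = 1) (h : (ρ * (1 - ketBra e)).trace = 0) :
    ρ = ketBra e := by
  set P := ketBra e with hP
  have hPP : P * P = P := ketBra_mul_ketBra he
  have hPh : Pᴴ = P := (posSemidef_ketBra e).isHermitian
  obtain ⟨B, rfl⟩ : ∃ B : M2, ρ = Bᴴ * B :=
    hρ.exists_eq_conjTranspose_mul_self
  -- With `ρ = Bᴴ B`, the squared Hilbert–Schmidt norm of `B (1 - P)` is `tr (ρ (1 - P)) = 0`.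
  have hB : B * (1 - P) = 0 := by
    rw [← Matrix.trace_conjTranspose_mul_self_eq_zero_iff, ← h, Matrix.conjTranspose_mul,
      Matrix.conjTranspose_sub, hPh, Matrix.conjTranspose_one, Matrix.mul_assoc,
      Matrix.trace_mul_comm]
    congr 1
    simp only [Matrix.mul_assoc]
    congr 2
    simp only [mul_sub, sub_mul, hPP, one_mul, mul_one]
    abel
  have hBP : B = B * P := by
    rw [mul_sub, mul_one, sub_eq_zero] at hB
    exact hB
  -- Thus `ρ = P ρ P`, which is a multiple of the rank-one `P`; the trace then fixes the scalar.
  have hc : Bᴴ * B = (star e.ofLp ⬝ᵥ (Bᴴ * B) *ᵥ e.ofLp) • P := by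
    have : Bᴴ * B = P * (Bᴴ * B) * P := by
      conv_lhs => rw [hBP]
      rw [Matrix.conjTranspose_mul, hPh]
      simp only [Matrix.mul_assoc]
    conv_lhs => rw [this]
    rw [hP, ketBra_eq_vecMulVec, Matrix.vecMulVec_mul, Matrix.vecMulVec_mul_vecMulVec,
      Matrix.dotProduct_mulVec, Matrix.vecMulVec_smul]
  have h2 := h1
  rw [hc, Matrix.trace_smul, trace_ketBra he, smul_eq_mul, mul_one] at h2
  rw [hc, h2, one_smul]

/-- The state of `P` vanishes on the positive element `1 - P`, so every component of a convex
decomposition vanishes there too and must be the state of `P`. -/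
theorem ketBra_mem_extremePoints {e : EuclideanSpace ℂ (Fin 2)} (he : ‖e‖ = 1) :
    traceFunctional (ketBra e) ∈ Set.extremePoints ℝ stateSpace := by
  refine ⟨traceFunctional_mem_stateSpace (posSemidef_ketBra e) (trace_ketBra he), ?_⟩
  intro ω₁ h₁ ω₂ h₂ ⟨a, b, ha, hb, hab, h⟩
  obtain ⟨ρ, hρ, hρ1, rfl⟩ := exists_density h₁
  set P := ketBra e with hP
  have hPP : P * P = P := ketBra_mul_ketBra he
  have hPh : Pᴴ = P := (posSemidef_ketBra e).isHermitian
  have hQ : 1 - P = (1 - P)ᴴ * (1 - P) := by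
    rw [Matrix.conjTranspose_sub, hPh, Matrix.conjTranspose_one]
    simp only [mul_sub, sub_mul, hPP, one_mul, mul_one]
    abel
  have p₁ := h₁.1 (1 - P)
  have p₂ := h₂.1 (1 - P)
  rw [← hQ] at p₁ p₂
  have hs := DFunLike.congr_fun h (1 - P)
  rw [traceFunctional_apply P, mul_sub, hPP, mul_one, sub_self, Matrix.trace_zero] at hs
  change (a : ℂ) * traceFunctional ρ (1 - P) + (b : ℂ) * ω₂ (1 - P) = 0 at hs
  have q₁ : 0 ≤ (a : ℂ) * traceFunctional ρ (1 - P) :=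
    mul_nonneg (by exact_mod_cast ha.le) p₁
  have q₂ : 0 ≤ (b : ℂ) * ω₂ (1 - P) := mul_nonneg (by exact_mod_cast hb.le) p₂
  have z₁ := ((add_eq_zero_iff_of_nonneg q₁ q₂).1 hs).1
  have z : traceFunctional ρ (1 - P) = 0 :=
    (mul_eq_zero.1 z₁).resolve_left (by exact_mod_cast ha.ne')
  rw [eq_ketBra_of_trace_mul he hρ hρ1 z]

/-! ### Spectral decompositions and orthogonal measures. -/

theorem sum_ketBra (e : OrthonormalBasis (Fin 2) ℂ (EuclideanSpace ℂ (Fin 2))) :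
    ketBra (e 0) + ketBra (e 1) = 1 := by
  ext i j
  have := e.sum_inner_mul_inner (EuclideanSpace.single i 1) (EuclideanSpace.single j 1)
  simpa [ketBra, Matrix.one_apply, EuclideanSpace.inner_single_left, EuclideanSpace.inner_single_right,
    PiLp.single_apply, eq_comm] using this

theorem exists_ketBra_decomposition {ρ : M2} (hρ : ρ.PosSemidef) :
    ∃ (e : OrthonormalBasis (Fin 2) ℂ (EuclideanSpace ℂ (Fin 2))) (a : Fin 2 → ℝ),
      (∀ i, 0 ≤ a i) ∧ ρ = ∑ i, (a i : ℂ) • ketBra (e i) := by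
  refine ⟨hρ.isHermitian.eigenvectorBasis, hρ.isHermitian.eigenvalues,
    hρ.eigenvalues_nonneg, ?_⟩
  conv_lhs => rw [hρ.isHermitian.spectral_theorem]
  ext i j
  simp [Unitary.conjStarAlgAut_apply, Matrix.mul_apply, Matrix.diagonal_apply, ketBra,
    Matrix.IsHermitian.eigenvectorUnitary_apply, Matrix.star_apply]
  ring

theorem exists_isOrthogonalMeasure {ω : WeakDual ℂ M2} (hω : ω ∈ stateSpace) :
    ∃ μ, IsOrthogonalMeasure ω μ := by
  obtain ⟨ρ, hρ, -, rfl⟩ := exists_density hω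
  obtain ⟨e, a, ha, h⟩ := exists_ketBra_decomposition hρ
  exact ⟨_, e, a, fun i => ⟨_, ketBra_mem_extremePoints (e.norm_eq_one i)⟩, ha, by rw [← h],
    fun i => rfl, rfl⟩

/-- An orthogonal measure representing a density matrix, with the smaller weight `l` singled out. -/
theorem IsOrthogonalMeasure.exists_two_point {ρ : M2} (h1 : ρ.trace = 1) {μ : Measure PureState}
    (h : IsOrthogonalMeasure (traceFunctional ρ) μ) :
    ∃ (l : ℝ) (P : M2) (x y : PureState), 0 ≤ l ∧ l ≤ 1 / 2 ∧ ρ.det = ((l * (1 - l) : ℝ) : ℂ) ∧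
      ρ = ((1 - 2 * l : ℝ) : ℂ) • P + (l : ℂ) • (1 : M2) ∧
      (x : WeakDual ℂ M2) = traceFunctional P ∧ (y : WeakDual ℂ M2) = traceFunctional (1 - P) ∧
      μ = ENNReal.ofReal (1 - l) • Measure.dirac x + ENNReal.ofReal l • Measure.dirac y := by
  obtain ⟨e, a, π, ha, hρ, hπ, hμ⟩ := h
  have hρ' := traceFunctional_injective hρ
  have hsum := sum_ketBra e
  rw [Fin.sum_univ_two] at hρ' hμ
  have ht : a 0 + a 1 = 1 := by
    rw [hρ'] at h1
    simp only [Matrix.trace_add, Matrix.trace_smul, trace_ketBra (e.norm_eq_one _), smul_eq_mul,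
      mul_one] at h1
    exact_mod_cast h1
  have hd : ρ.det = ((a 0 * a 1 : ℝ) : ℂ) := by
    have t0 := trace_ketBra (e.norm_eq_one 0)
    have d0 := det_ketBra (e 0)
    -- Eliminating the second projection gives `ρ = (a 0 - a 1) P + a 1`, whose determinant depends
    -- only on `det P = 0` and `tr P = 1`.
    rw [hρ', ← sub_eq_of_eq_add' hsum.symm]
    rw [Matrix.trace_fin_two] at t0
    rw [Matrix.det_fin_two] at d0 ⊢
    simp
    linear_combination (a 0 - a 1 : ℂ) ^ 2 * d0 + (a 1 * (a 0 - a 1) : ℂ) * t0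
  rcases le_total (a 1) (a 0) with hle | hle
  · refine ⟨a 1, ketBra (e 0), π 0, π 1, ha 1, by linarith, ?_, ?_, hπ 0, ?_, ?_⟩
    · rw [hd, ← ht]; congr 1; ring
    · rw [hρ', ← hsum, show (1 - 2 * a 1 : ℝ) = a 0 - a 1 by linarith]
      push_cast
      module
    · rw [hπ 1, ← hsum, add_sub_cancel_left]
    · rw [hμ, show 1 - a 1 = a 0 by linarith]
  · refine ⟨a 0, ketBra (e 1), π 1, π 0, ha 0, by linarith, ?_, ?_, hπ 1, ?_, ?_⟩
    · rw [hd, ← ht]; congr 1; ring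
    · rw [hρ', ← hsum, show (1 - 2 * a 0 : ℝ) = a 1 - a 0 by linarith]
      push_cast
      module
    · rw [hπ 0, ← hsum, add_sub_cancel_right]
    · rw [hμ, show 1 - a 0 = a 1 by linarith, add_comm]

/-! ### The semigroup at `ν = 0` -/

/-- On an eigenvector the exponential series collapses to a scalar one, so an eigenbasis of the
generator determines the semigroup. -/
theorem NormedSpace.exp_smul_apply_of_apply_eq_smul {E : Type*} [NormedAddCommGroup E]
    [NormedSpace ℂ E] [CompleteSpace E] {L : E →L[ℂ] E} {v : E} {c : ℂ} (h : L v = c • v) (z : ℂ) :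
    (NormedSpace.exp (z • L) : E →L[ℂ] E) v = Complex.exp (z * c) • v := by
  have hp : ∀ n : ℕ, ((z • L) ^ n) v = (z * c) ^ n • v := by
    intro n
    induction n with
    | zero => simp
    | succ n ih =>
      rw [pow_succ', mul_apply_eq_comp, ih, map_smul, smul_apply, h,
        smul_smul, smul_smul, pow_succ, mul_assoc]
  have h1 := (ContinuousLinearMap.apply ℂ E v).hasSum
    (NormedSpace.exp_series_hasSum_exp' (𝕂 := ℂ) (z • L))
  have h2 := (NormedSpace.exp_series_hasSum_exp' (𝕂 := ℂ) (z * c)).smul_const v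
  rw [← Complex.exp_eq_exp_ℂ] at h2
  refine h1.unique ?_
  convert h2 using 2 with n
  change ((n.factorial : ℂ)⁻¹) • ((z • L) ^ n) v = _
  rw [hp, smul_assoc]

theorem wclPredual_apply_of_eigen {η ν ξ : ℝ} {ζ : ℂ} {v : M2} {c : ℂ}
    (h : wclGenFun η ν ξ ζ v = c • v) (t : ℝ) :
    wclPredual η ν ξ ζ t v = Complex.exp (t * c) • v := by
  open scoped Matrix.Norms.L2Operator in
  exact NormedSpace.exp_smul_apply_of_apply_eq_smul
    (L := LinearMap.toContinuousLinearMap (wclGen η ν ξ ζ)) h t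

theorem wclGenFun_vacuum (η ξ : ℝ) (ρ : M2) :
    wclGenFun η 0 ξ 0 ρ = !![-η * ρ 0 0, (-2 * Complex.I * ξ - η / 2) * ρ 0 1;
      (2 * Complex.I * ξ - η / 2) * ρ 1 0, η * ρ 0 0] := by
  ext i j
  have hD : lowerDᴴ = !![0, 1; 0, 0] := by
    ext i j; fin_cases i <;> fin_cases j <;> simp [lowerD]
  rw [wclGenFun, hD]
  fin_cases i <;> fin_cases j <;>
    simp [lowerD, Matrix.mul_apply, Matrix.vecMul, dotProduct, Fin.sum_univ_two] <;> ring

theorem wclPredual_vacuum (η ξ : ℝ) (t : ℝ) (ρ : M2) :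
    wclPredual η 0 ξ 0 t ρ =
      !![(Real.exp (-η * t) : ℂ) * ρ 0 0, Complex.exp (t * (-2 * Complex.I * ξ - η / 2)) * ρ 0 1;
        Complex.exp (t * (2 * Complex.I * ξ - η / 2)) * ρ 1 0,
        ρ 0 0 + ρ 1 1 - (Real.exp (-η * t) : ℂ) * ρ 0 0] := by
  -- Expansion in eigenvectors of the generator: population imbalance (eigenvalue `-η`), the two
  -- coherences, and the invariant lower level (eigenvalue 0).
  have hρ : ρ = ρ 0 0 • !![1, 0; 0, -1] + ρ 0 1 • !![0, 1; 0, 0] + ρ 1 0 • !![0, 0; 1, 0] +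
      (ρ 0 0 + ρ 1 1) • !![0, 0; 0, 1] := by
    ext i j; fin_cases i <;> fin_cases j <;> simp
  have e1 : wclPredual η 0 ξ 0 t !![1, 0; 0, -1] = _ :=
    wclPredual_apply_of_eigen (c := -η) (by
      rw [wclGenFun_vacuum]; ext i j; fin_cases i <;> fin_cases j <;> simp) t
  have e2 : wclPredual η 0 ξ 0 t !![0, 1; 0, 0] = _ :=
    wclPredual_apply_of_eigen (c := -2 * Complex.I * ξ - η / 2) (by
      rw [wclGenFun_vacuum]; ext i j; fin_cases i <;> fin_cases j <;> simp) t
  have e3 : wclPredual η 0 ξ 0 t !![0, 0; 1, 0] = _ :=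
    wclPredual_apply_of_eigen (c := 2 * Complex.I * ξ - η / 2) (by
      rw [wclGenFun_vacuum]; ext i j; fin_cases i <;> fin_cases j <;> simp) t
  have e4 : wclPredual η 0 ξ 0 t !![0, 0; 0, 1] = _ :=
    wclPredual_apply_of_eigen (c := 0) (by
      rw [wclGenFun_vacuum]; ext i j; fin_cases i <;> fin_cases j <;> simp) t
  conv_lhs => rw [hρ]
  rw [map_add, map_add, map_add, map_smul, map_smul, map_smul, map_smul, e1, e2, e3, e4]
  ext i j
  fin_cases i <;> fin_cases j <;> simp [mul_comm (t : ℂ)] <;> ring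

theorem wclEvolve_traceFunctional (η ν ξ : ℝ) (ζ : ℂ) (t : ℝ) (ρ : M2) :
    wclEvolve η ν ξ ζ t (traceFunctional ρ) = traceFunctional (wclPredual η ν ξ ζ t ρ) :=
  DFunLike.ext _ _ fun x => by
    rw [wclEvolve_apply, traceFunctional_apply, traceFunctional_apply, wclSemigroup,
      trace_traceDual]

theorem rhoInfty_vacuum {η : ℝ} (hη : η ≠ 0) : rhoInfty η 0 = !![0, 0; 0, 1] := by
  have : (η : ℂ) ≠ 0 := by exact_mod_cast hη
  ext i j
  fin_cases i <;> fin_cases j <;> simp [rhoInfty, pauli3, this]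
  norm_num

theorem one_sub_rhoInfty_vacuum {η : ℝ} (hη : η ≠ 0) : 1 - rhoInfty η 0 = !![1, 0; 0, 0] := by
  rw [rhoInfty_vacuum hη]
  ext i j
  fin_cases i <;> fin_cases j <;> simp

/-! ### Large deviations for two-point measures -/

/-- Multiplicative constants contribute only `O(1/t)` to the normalized logarithm. -/
theorem tendsto_log_div_atTop {f : ℝ → ℝ} {η c C : ℝ} (hc : 0 < c)
    (hf : ∀ᶠ t in atTop, c * Real.exp (-η * t) ≤ f t ∧ f t ≤ C * Real.exp (-η * t)) :
    Tendsto (fun t => Real.log (f t) / t) atTop (𝓝 (-η)) := by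
  have key : ∀ b : ℝ, Tendsto (fun t : ℝ => b / t + -η) atTop (𝓝 (-η)) := fun b => by
    simpa using (tendsto_const_nhds (x := b)).div_atTop tendsto_id |>.add_const (-η)
  have hlog : ∀ b : ℝ, 0 < b → ∀ t : ℝ, 0 < t →
      Real.log (b * Real.exp (-η * t)) / t = Real.log b / t + -η := fun b hb t ht => by
    rw [Real.log_mul hb.ne' (Real.exp_ne_zero _), Real.log_exp]
    field_simp
  refine tendsto_of_tendsto_of_tendsto_of_le_of_le' (key (Real.log c)) (key (Real.log C)) ?_ ?_
  · filter_upwards [hf, eventually_gt_atTop 0] with t h ht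
    rw [← hlog c hc t ht]
    have := Real.exp_pos (-η * t)
    gcongr
    exact h.1
  · filter_upwards [hf, eventually_gt_atTop 0] with t h ht
    have hpos : 0 < c * Real.exp (-η * t) := by positivity
    have hC : 0 < C := pos_of_mul_pos_left (hpos.trans_le (h.1.trans h.2)) (Real.exp_pos _).le
    rw [← hlog C hC t ht]
    gcongr
    · exact hpos.trans_le h.1
    · exact h.2

theorem tendsto_rpow_of_log {f : ℝ → ℝ} {a : ℝ} (hf : ∀ᶠ t in atTop, 0 < f t)
    (h : Tendsto (fun t => Real.log (f t) / t) atTop (𝓝 a)) :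
    Tendsto (fun t => ENNReal.ofReal (f t) ^ (1 / t)) atTop (𝓝 (ENNReal.ofReal (Real.exp a))) := by
  refine (ENNReal.tendsto_ofReal ((Real.continuous_exp.tendsto a).comp h)).congr' ?_
  filter_upwards [hf] with t ht
  rw [ENNReal.ofReal_rpow_of_pos ht, Real.rpow_def_of_pos ht, mul_one_div]
  rfl

open Classical in
-- The heavy weight lies in `[1/2, 1]`, so its `1/t` power tends to 1, while that of the light
-- weight tends to `exp (-η)`. Convergence of the atoms puts them eventually inside an open set
-- containing their limit, or outside a closed set missing it.
theorem satisfiesLDP_two_point {X : Type*} [TopologicalSpace X] [T1Space X] [MeasurableSpace X]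
    [BorelSpace X] {η : ℝ} (hη : 0 < η) {μ : ℝ → Measure X} {l : ℝ → ℝ} {x y : ℝ → X} {x₀ y₀ : X}
    (hμ : ∀ t, 0 ≤ t → 0 ≤ l t ∧ l t ≤ 1 / 2 ∧ μ t =
      ENNReal.ofReal (1 - l t) • Measure.dirac (x t) + ENNReal.ofReal (l t) • Measure.dirac (y t))
    (hpos : ∀ᶠ t in atTop, 0 < l t)
    (hl : Tendsto (fun t => Real.log (l t) / t) atTop (𝓝 (-η)))
    (hx : Tendsto x atTop (𝓝 x₀)) (hy : Tendsto y atTop (𝓝 y₀)) :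
    SatisfiesLDP μ (fun z => if z = x₀ then 0 else if z = y₀ then ENNReal.ofReal η else ⊤) := by
  set J : X → ℝ≥0∞ := fun z => if z = x₀ then 0 else if z = y₀ then ENNReal.ofReal η else ⊤
    with hJ
  have hprob : ∀ t, 0 ≤ t → IsProbabilityMeasure (μ t) := fun t ht => by
    obtain ⟨h0, h1, h⟩ := hμ t ht
    constructor
    rw [h]
    simp only [Measure.coe_add, Measure.coe_smul, Pi.add_apply, Pi.smul_apply, measure_univ,
      smul_eq_mul, mul_one]
    rw [← ENNReal.ofReal_add (by linarith) h0]
    simp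
  have hexp : EReal.exp (-((ENNReal.ofReal η : ℝ≥0∞) : EReal)) = ENNReal.ofReal (Real.exp (-η)) := by
    rw [EReal.coe_ennreal_ofReal, max_eq_left hη.le, ← EReal.coe_neg, EReal.exp_coe]
  have hL := tendsto_rpow_of_log hpos hl
  have hlx : Tendsto (fun t => ENNReal.ofReal (1 - l t) ^ (1 / t)) atTop (𝓝 1) := by
    have hb : Tendsto (fun t : ℝ => ENNReal.ofReal (1 / 2) ^ (1 / t)) atTop (𝓝 1) := by
      have := tendsto_rpow_of_log (f := fun _ => 1 / 2) (a := 0)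
        (Eventually.of_forall fun _ => by norm_num)
        ((tendsto_const_nhds (x := Real.log (1 / 2))).div_atTop tendsto_id)
      simpa using this
    refine tendsto_of_tendsto_of_tendsto_of_le_of_le' hb tendsto_const_nhds ?_ ?_
    · filter_upwards [eventually_gt_atTop 0] with t ht
      have := hμ t ht.le
      exact ENNReal.rpow_le_rpow (ENNReal.ofReal_le_ofReal (by linarith)) (by positivity)
    · filter_upwards [eventually_gt_atTop 0] with t ht
      have := hμ t ht.le
      exact ENNReal.rpow_le_one (ENNReal.ofReal_le_one.2 (by linarith)) (by positivity)
  refine ⟨hprob, ?_, fun F hF => ?_, fun G hG => ?_⟩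
  · rw [lowerSemicontinuous_iff_isClosed_preimage]
    intro c
    by_cases hc : c = ⊤
    · simp [hc]
    -- Sublevel sets at finite levels are contained in `{x₀, y₀}`, and finite sets are closed in a
    -- T1 space.
    · refine Set.Finite.isClosed ((Set.toFinite {x₀, y₀}).subset fun z hz => ?_)
      by_contra hn
      simp only [Set.mem_insert_iff, Set.mem_singleton_iff, not_or] at hn
      simp [hJ, hn.1, hn.2, hc] at hz
  · by_cases hxF : x₀ ∈ F
    · have h1 : 1 ≤ ⨆ x ∈ F, EReal.exp (-(J x : EReal)) := by
        refine le_trans ?_ (le_iSup₂ x₀ hxF)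
        simp [hJ]
      refine le_trans (limsup_le_of_le (by isBoundedDefault) ?_) h1
      filter_upwards [eventually_gt_atTop 0] with t ht
      have := hprob t ht.le
      exact ENNReal.rpow_le_one prob_le_one (by positivity)
    have ex : ∀ᶠ t in atTop, x t ∉ F := hx.eventually (hF.isOpen_compl.mem_nhds hxF)
    by_cases hyF : y₀ ∈ F
    · have hxy : y₀ ≠ x₀ := fun h => hxF (h ▸ hyF)
      have h1 : ENNReal.ofReal (Real.exp (-η)) ≤ ⨆ x ∈ F, EReal.exp (-(J x : EReal)) := by
        refine le_trans ?_ (le_iSup₂ y₀ hyF)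
        simp only [hJ, if_neg hxy, if_true, hexp, le_refl]
      refine le_trans ?_ h1
      rw [← hL.limsup_eq]
      refine limsup_le_limsup ?_ (by isBoundedDefault) (by isBoundedDefault)
      filter_upwards [eventually_gt_atTop 0, ex] with t ht hxt
      refine ENNReal.rpow_le_rpow ?_ (by positivity)
      rw [(hμ t ht.le).2.2]
      simp only [Measure.coe_add, Measure.coe_smul, Pi.add_apply, Pi.smul_apply, smul_eq_mul,
        Measure.dirac_apply' _ hF.measurableSet, Set.indicator_of_notMem hxt, mul_zero, zero_add]
      exact mul_le_of_le_one_right' (Set.indicator_le_self' (by simp) _)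
    · have ey : ∀ᶠ t in atTop, y t ∉ F := hy.eventually (hF.isOpen_compl.mem_nhds hyF)
      refine le_trans (limsup_le_of_le (by isBoundedDefault) ?_) zero_le
      filter_upwards [eventually_gt_atTop 0, ex, ey] with t ht hxt hyt
      rw [(hμ t ht.le).2.2]
      simp only [Measure.coe_add, Measure.coe_smul, Pi.add_apply, Pi.smul_apply, smul_eq_mul,
        Measure.dirac_apply' _ hF.measurableSet, Set.indicator_of_notMem hxt,
        Set.indicator_of_notMem hyt, mul_zero, zero_add]
      rw [ENNReal.zero_rpow_of_pos (by positivity)]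
  · refine iSup₂_le fun z hz => ?_
    by_cases hzx : z = x₀
    · subst hzx
      have ex : ∀ᶠ t in atTop, x t ∈ G := hx.eventually (hG.mem_nhds hz)
      simp only [hJ, if_true, EReal.coe_ennreal_zero, neg_zero, EReal.exp_zero]
      rw [← hlx.liminf_eq]
      refine liminf_le_liminf ?_ (by isBoundedDefault) (by isBoundedDefault)
      filter_upwards [eventually_gt_atTop 0, ex] with t ht hxt
      refine ENNReal.rpow_le_rpow ?_ (by positivity)
      rw [(hμ t ht.le).2.2]
      simp only [Measure.coe_add, Measure.coe_smul, Pi.add_apply, Pi.smul_apply, smul_eq_mul,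
        Measure.dirac_apply' _ hG.measurableSet, Set.indicator_of_mem hxt, Pi.one_apply, mul_one]
      exact le_self_add
    by_cases hzy : z = y₀
    · have ey : ∀ᶠ t in atTop, y t ∈ G := hy.eventually (hG.mem_nhds (hzy ▸ hz))
      simp only [hJ, if_neg hzx, if_pos hzy, hexp]
      rw [← hL.liminf_eq]
      refine liminf_le_liminf ?_ (by isBoundedDefault) (by isBoundedDefault)
      filter_upwards [eventually_gt_atTop 0, ey] with t ht hyt
      refine ENNReal.rpow_le_rpow ?_ (by positivity)
      rw [(hμ t ht.le).2.2]
      simp only [Measure.coe_add, Measure.coe_smul, Pi.add_apply, Pi.smul_apply, smul_eq_mul,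
        Measure.dirac_apply' _ hG.measurableSet, Set.indicator_of_mem hyt, Pi.one_apply, mul_one]
      exact le_add_self
    · simp [hJ, hzx, hzy]

/-! ### Asymptotics of the semigroup at `ν = 0` -/

theorem continuous_traceFunctional : Continuous traceFunctional :=
  WeakDual.continuous_of_continuous_eval fun x => by
    simp only [traceFunctional_apply]
    fun_prop

/-- Two real eigenvalues with sum 1 and nonnegative product are both nonnegative. This gives
positivity of the evolved state without any appeal to complete positivity. -/
theorem posSemidef_of_trace_eq_one {M : M2} (hM : M.IsHermitian) (h1 : M.trace = 1)
    (hd : 0 ≤ M.det) : M.PosSemidef := by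
  rw [hM.trace_eq_sum_eigenvalues, Fin.sum_univ_two] at h1
  rw [hM.det_eq_prod_eigenvalues, Fin.prod_univ_two] at hd
  have h1' : hM.eigenvalues 0 + hM.eigenvalues 1 = 1 :=
    RCLike.ofReal_injective (K := ℂ) (by rw [RCLike.ofReal_add, RCLike.ofReal_one, ← h1])
  have hd' : 0 ≤ hM.eigenvalues 0 * hM.eigenvalues 1 :=
    RCLike.ofReal_nonneg (K := ℂ).1 (by rwa [RCLike.ofReal_mul])
  rw [hM.posSemidef_iff_eigenvalues_nonneg]
  intro i
  fin_cases i <;> simp only [Pi.zero_apply, Fin.zero_eta, Fin.mk_one] <;> nlinarith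

theorem rhoInfty_vacuum_eq_ketBra {η : ℝ} (hη : η ≠ 0) :
    rhoInfty η 0 = ketBra (EuclideanSpace.single 1 1) := by
  rw [rhoInfty_vacuum hη]
  ext i j
  fin_cases i <;> fin_cases j <;> simp [ketBra]

theorem one_sub_rhoInfty_vacuum_eq_ketBra {η : ℝ} (hη : η ≠ 0) :
    1 - rhoInfty η 0 = ketBra (EuclideanSpace.single 0 1) := by
  rw [one_sub_rhoInfty_vacuum hη]
  ext i j
  fin_cases i <;> fin_cases j <;> simp [ketBra]

/-- The entries of a density matrix other than the absorbing one. -/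
theorem exists_entries_of_ne_rhoInfty {η : ℝ} (hη : η ≠ 0) {ρ : M2} (hρ : ρ.PosSemidef)
    (h1 : ρ.trace = 1) (hne : ρ ≠ rhoInfty η 0) :
    ∃ (a : ℝ) (b : ℂ), 0 < a ∧ Complex.normSq b ≤ a * (1 - a) ∧
      ρ = !![(a : ℂ), b; star b, ((1 - a : ℝ) : ℂ)] := by
  have h00 := Complex.nonneg_iff.1 (hρ.diag_nonneg (i := 0))
  set a := (ρ 0 0).re with ha
  have ha' : ρ 0 0 = a := Complex.ext rfl h00.2.symm
  have h10 : ρ 1 0 = star (ρ 0 1) := (hρ.isHermitian.apply 1 0).symm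
  have h11 : ρ 1 1 = ((1 - a : ℝ) : ℂ) := by
    rw [Matrix.trace_fin_two, ha'] at h1
    push_cast
    linear_combination h1
  have hd : Complex.normSq (ρ 0 1) ≤ a * (1 - a) := by
    have hd := hρ.det_nonneg
    have hb : ρ 0 1 * star (ρ 0 1) = (Complex.normSq (ρ 0 1) : ℂ) := Complex.mul_conj _
    rw [Matrix.det_fin_two, h10, h11, ha', hb] at hd
    have : 0 ≤ a * (1 - a) - Complex.normSq (ρ 0 1) := by exact_mod_cast hd
    linarith
  have hρ' : ρ = !![(a : ℂ), ρ 0 1; star (ρ 0 1), ((1 - a : ℝ) : ℂ)] := by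
    ext i j
    fin_cases i <;> fin_cases j <;> first | assumption | rfl
  -- If `a = 0`, the determinant bound kills the off-diagonal entry and leaves only `ρ_∞`.
  refine ⟨a, ρ 0 1, h00.1.lt_of_ne fun h0 => hne ?_, hd, hρ'⟩
  rw [← h0] at hd hρ'
  have h01 : ρ 0 1 = 0 := Complex.normSq_eq_zero.1
    (le_antisymm (by simpa using hd) (Complex.normSq_nonneg _))
  rw [hρ', rhoInfty_vacuum hη, h01]
  simp

/-- The determinant of the evolved density matrix. -/
theorem det_wclPredual_vacuum (η ξ t a : ℝ) (b : ℂ) :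
    (wclPredual η 0 ξ 0 t !![(a : ℂ), b; star b, ((1 - a : ℝ) : ℂ)]).det =
      ((Real.exp (-η * t) * (a * (1 - Real.exp (-η * t) * a) - Complex.normSq b) : ℝ) : ℂ) := by
  -- The opposite phases cancel, so the determinant does not depend on `ξ`.
  have he : Complex.exp (t * (-2 * Complex.I * ξ - η / 2)) *
      Complex.exp (t * (2 * Complex.I * ξ - η / 2)) = (Real.exp (-η * t) : ℂ) := by
    rw [← Complex.exp_add, Complex.ofReal_exp]
    congr 1
    push_cast
    ring
  have hb : b * star b = (Complex.normSq b : ℂ) := Complex.mul_conj b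
  rw [wclPredual_vacuum, Matrix.det_fin_two]
  push_cast at he ⊢
  simp only [Matrix.of_apply, Matrix.cons_val', Matrix.cons_val_zero, Matrix.cons_val_one,
    Matrix.cons_val_fin_one]
  linear_combination (-(b * star b)) * he - Complex.exp (-η * t) * hb

theorem trace_wclPredual_vacuum (η ξ t : ℝ) (ρ : M2) :
    (wclPredual η 0 ξ 0 t ρ).trace = ρ.trace := by
  rw [wclPredual_vacuum, Matrix.trace_fin_two, Matrix.trace_fin_two]
  simp

theorem isHermitian_wclPredual_vacuum (η ξ t : ℝ) {ρ : M2} (hρ : ρ.IsHermitian) :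
    (wclPredual η 0 ξ 0 t ρ).IsHermitian := by
  have h00 : (starRingEnd ℂ) (ρ 0 0) = ρ 0 0 := hρ.apply 0 0
  have h11 : (starRingEnd ℂ) (ρ 1 1) = ρ 1 1 := hρ.apply 1 1
  have h01 : (starRingEnd ℂ) (ρ 0 1) = ρ 1 0 := hρ.apply 1 0
  have h10 : (starRingEnd ℂ) (ρ 1 0) = ρ 0 1 := hρ.apply 0 1
  rw [wclPredual_vacuum]
  ext i j
  fin_cases i <;> fin_cases j <;>
    simp [h00, h11, h01, h10, ← Complex.exp_conj, map_ofNat (starRingEnd ℂ) 2]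

theorem tendsto_wclPredual_vacuum {η : ℝ} (hη : 0 < η) (ξ : ℝ) {ρ : M2} (h1 : ρ.trace = 1) :
    Tendsto (fun t : ℝ => wclPredual η 0 ξ 0 t ρ) atTop (𝓝 (rhoInfty η 0)) := by
  have key : ∀ c : ℂ, c.re < 0 → Tendsto (fun t : ℝ => Complex.exp (t * c)) atTop (𝓝 0) :=
    fun c hc => by
      rw [Complex.tendsto_exp_nhds_zero_iff]
      simpa using tendsto_id.atTop_mul_const_of_neg hc
  have h0 := key (-η) (by simpa using hη)
  have h2 := key (-2 * Complex.I * ξ - η / 2) (by simp; linarith)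
  have h3 := key (2 * Complex.I * ξ - η / 2) (by simp; linarith)
  have h0' : Tendsto (fun t : ℝ => (Real.exp (-η * t) : ℂ)) atTop (𝓝 0) := by
    refine h0.congr fun t => ?_
    push_cast
    ring_nf
  rw [Matrix.trace_fin_two] at h1
  rw [rhoInfty_vacuum hη.ne']
  refine tendsto_pi_nhds.2 fun i => tendsto_pi_nhds.2 fun j => ?_
  simp only [wclPredual_vacuum]
  fin_cases i <;> fin_cases j
  · simpa using h0'.mul_const (ρ 0 0)
  · simpa using h2.mul_const (ρ 0 1)
  · simpa using h3.mul_const (ρ 1 0)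
  · simpa [h1] using (h0'.mul_const (ρ 0 0)).const_sub 1

theorem posSemidef_wclPredual_vacuum {η : ℝ} (hη : 0 < η) (ξ : ℝ) {a : ℝ} {b : ℂ}
    (hb : Complex.normSq b ≤ a * (1 - a)) {t : ℝ} (ht : 0 ≤ t) :
    (wclPredual η 0 ξ 0 t !![(a : ℂ), b; star b, ((1 - a : ℝ) : ℂ)]).PosSemidef := by
  refine posSemidef_of_trace_eq_one (isHermitian_wclPredual_vacuum _ _ _ ?_) ?_ ?_
  · ext i j
    fin_cases i <;> fin_cases j <;> simp
  · rw [trace_wclPredual_vacuum, Matrix.trace_fin_two]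
    simp
  · rw [det_wclPredual_vacuum]
    have hE : Real.exp (-η * t) ≤ 1 := Real.exp_le_one_iff.2 (by nlinarith)
    have hE0 := Real.exp_pos (-η * t)
    -- By the bound on `|b|²`, the second factor is at least `a² (1 - E) ≥ 0`.
    exact_mod_cast mul_nonneg hE0.le (by nlinarith [mul_nonneg (sub_nonneg.2 hE) (sq_nonneg a)])

/-- The large deviation principle for the orthogonal measures. -/
theorem satisfiesLDP_of_isOrthogonalMeasure {η : ℝ} (hη : 0 < η) (ξ : ℝ) {a : ℝ} {b : ℂ}
    (ha : 0 < a) (hb : Complex.normSq b ≤ a * (1 - a)) {μ : ℝ → Measure PureState}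
    (hμ : ∀ t : ℝ, 0 ≤ t → IsOrthogonalMeasure (traceFunctional
      (wclPredual η 0 ξ 0 t !![(a : ℂ), b; star b, ((1 - a : ℝ) : ℂ)])) (μ t)) :
    SatisfiesLDP μ (wclRate η 0) := by
  set R : ℝ → M2 := fun t => wclPredual η 0 ξ 0 t !![(a : ℂ), b; star b, ((1 - a : ℝ) : ℂ)]
  have h1 : Matrix.trace !![(a : ℂ), b; star b, ((1 - a : ℝ) : ℂ)] = 1 := by
    rw [Matrix.trace_fin_two]
    simp
  let x₀ : PureState := ⟨traceFunctional (rhoInfty η 0), by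
    rw [rhoInfty_vacuum_eq_ketBra hη.ne']
    exact ketBra_mem_extremePoints (by simp)⟩
  let y₀ : PureState := ⟨traceFunctional (1 - rhoInfty η 0), by
    rw [one_sub_rhoInfty_vacuum_eq_ketBra hη.ne']
    exact ketBra_mem_extremePoints (by simp)⟩
  -- `choose!` needs default atoms for negative times.
  have : Nonempty PureState := ⟨x₀⟩
  have hdec := fun t ht => (hμ t ht).exists_two_point ((trace_wclPredual_vacuum _ _ _ _).trans h1)
  choose! l P x y hl0 hl hdet hR hx hy hμ' using hdec
  have hexp : Tendsto (fun t : ℝ => Real.exp (-η * t)) atTop (𝓝 0) :=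
    Real.tendsto_exp_atBot.comp (tendsto_id.const_mul_atTop_of_neg (by linarith))
  have hlg : ∀ t, 0 ≤ t → l t * (1 - l t) =
      Real.exp (-η * t) * (a * (1 - Real.exp (-η * t) * a) - Complex.normSq b) := fun t ht => by
    have := hdet t ht
    rw [det_wclPredual_vacuum] at this
    exact_mod_cast this.symm
  -- Once `E ≤ 1/2`, the bracket in `hlg` lies between `a² / 2` and `a`. Since `0 ≤ l ≤ 1/2`, also
  -- `l (1 - l) ≤ l ≤ 2 l (1 - l)`.
  have hbound : ∀ᶠ t in atTop, a ^ 2 / 2 * Real.exp (-η * t) ≤ l t ∧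
      l t ≤ 2 * a * Real.exp (-η * t) := by
    filter_upwards [eventually_ge_atTop 0, hexp.eventually_le_const (show (0 : ℝ) < 1 / 2 by simp)]
      with t ht hE
    have h := hlg t ht
    have h0 := hl0 t ht
    have h2 := hl t ht
    have hE0 := Real.exp_pos (-η * t)
    set E := Real.exp (-η * t)
    have hn := Complex.normSq_nonneg b
    constructor
    · have : a ^ 2 / 2 ≤ a * (1 - E * a) - Complex.normSq b := by nlinarith [sq_nonneg a]
      nlinarith [mul_le_mul_of_nonneg_left this hE0.le]
    · have : a * (1 - E * a) - Complex.normSq b ≤ a := by nlinarith [mul_pos hE0 (mul_pos ha ha)]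
      nlinarith [mul_le_mul_of_nonneg_left this hE0.le]
  have hlpos : ∀ᶠ t in atTop, 0 < l t := by
    filter_upwards [hbound] with t h
    exact lt_of_lt_of_le (by positivity) h.1
  have hllim : Tendsto l atTop (𝓝 0) := by
    refine tendsto_of_tendsto_of_tendsto_of_le_of_le' tendsto_const_nhds
      (by simpa using hexp.const_mul (2 * a)) (hlpos.mono fun _ h => h.le)
      (hbound.mono fun _ h => h.2)
  have hlC : Tendsto (fun t => (l t : ℂ)) atTop (𝓝 0) := by
    exact_mod_cast (Complex.continuous_ofReal.tendsto 0).comp hllim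
  have hPlim : Tendsto P atTop (𝓝 (rhoInfty η 0)) := by
    -- Solving `R = (1 - 2 l) P + l` for the dominant projection is legitimate once `l < 1/2`, so no
    -- control of eigenvectors is needed.
    have hlim : Tendsto (fun t => (1 - 2 * (l t : ℂ))⁻¹ • (R t - (l t : ℂ) • (1 : M2))) atTop
        (𝓝 ((1 - 2 * (0 : ℂ))⁻¹ • (rhoInfty η 0 - (0 : ℂ) • (1 : M2)))) :=
      (((hlC.const_mul 2).const_sub 1).inv₀ (by simp)).smul
        ((tendsto_wclPredual_vacuum hη ξ h1).sub (hlC.smul_const 1))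
    simp only [mul_zero, sub_zero, inv_one, one_smul, zero_smul] at hlim
    refine hlim.congr' ?_
    filter_upwards [eventually_ge_atTop 0, hllim.eventually_lt_const (show (0 : ℝ) < 1 / 2 by simp)]
      with t ht hlt
    have hne : (1 - 2 * (l t : ℂ)) ≠ 0 := by
      have : 1 - 2 * l t ≠ 0 := by linarith
      exact_mod_cast this
    simp only [R]
    rw [hR t ht, add_sub_cancel_right, smul_smul]
    push_cast
    rw [inv_mul_cancel₀ hne, one_smul]
  have hxlim : Tendsto x atTop (𝓝 x₀) := by
    rw [tendsto_subtype_rng]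
    refine ((continuous_traceFunctional.tendsto _).comp hPlim).congr' ?_
    filter_upwards [eventually_ge_atTop 0] with t ht using (hx t ht).symm
  have hylim : Tendsto y atTop (𝓝 y₀) := by
    rw [tendsto_subtype_rng]
    refine ((continuous_traceFunctional.tendsto _).comp (hPlim.const_sub 1)).congr' ?_
    filter_upwards [eventually_ge_atTop 0] with t ht using (hy t ht).symm
  convert satisfiesLDP_two_point hη (fun t ht => ⟨hl0 t ht, hl t ht, hμ' t ht⟩) hlpos
    (tendsto_log_div_atTop (by positivity) hbound) hxlim hylim using 1
  funext z
  have hzx : z = x₀ ↔ (z : WeakDual ℂ M2) = traceFunctional (rhoInfty η 0) := Subtype.ext_iff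
  have hzy : z = y₀ ↔ (z : WeakDual ℂ M2) = traceFunctional (1 - rhoInfty η 0) := Subtype.ext_iff
  rw [wclRate]
  by_cases h : z = x₀
  · rw [if_pos h, if_pos (hzx.1 h)]
  · rw [if_neg h, if_neg (hzx.not.1 h)]
    by_cases h' : z = y₀
    · rw [if_pos h', if_pos (hzy.1 h')]
    · rw [if_neg h', if_neg (hzy.not.1 h')]

/-! ### Exponential rates of projections. -/

theorem IsStarProjection.eq_of_apply_one_one_eq_zero {p : M2} (hp : IsStarProjection p)
    (hp0 : p ≠ 0) (h : p 1 1 = 0) : p = !![1, 0; 0, 0] := by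
  have hm := hp.isIdempotentElem.eq
  have hs : pᴴ = p := hp.isSelfAdjoint
  have h10 : p 1 0 = star (p 0 1) := by
    conv_lhs => rw [← hs]
    rfl
  have h11 := congrFun (congrFun hm 1) 1
  have h00 := congrFun (congrFun hm 0) 0
  simp only [Matrix.mul_apply, Fin.sum_univ_two] at h00 h11
  have h01 : p 0 1 = 0 := by
    rw [h, h10] at h11
    simpa using h11
  have h10' : p 1 0 = 0 := by rw [h10, h01, star_zero]
  have h1 : p 0 0 = 1 := by
    rw [h01, zero_mul, add_zero] at h00
    refine (mul_eq_left₀ fun h0 => hp0 ?_).1 h00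
    ext i j
    fin_cases i <;> fin_cases j <;> assumption
  ext i j
  fin_cases i <;> fin_cases j <;> assumption

theorem tendsto_log_evolve_projection {η : ℝ} (hη : 0 < η) (ξ : ℝ) {a : ℝ} {b : ℂ}
    (ha : 0 < a) (hb : Complex.normSq b ≤ a * (1 - a)) {p : M2} (hp : IsStarProjection p)
    (hp0 : p ≠ 0) {f : ℝ → ℂ} (hf : ∀ t, f t = traceFunctional
      (wclPredual η 0 ξ 0 t !![(a : ℂ), b; star b, ((1 - a : ℝ) : ℂ)]) p) :
    (∀ᶠ t : ℝ in atTop, 0 < f t) ∧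
      Tendsto (fun t : ℝ => (1 / t) * Real.log (f t).re) atTop
        (𝓝 (open Classical in if p = 1 - rhoInfty η 0 then -η else 0)) := by
  have h1 : Matrix.trace !![(a : ℂ), b; star b, ((1 - a : ℝ) : ℂ)] = 1 := by
    rw [Matrix.trace_fin_two]
    simp
  rw [one_sub_rhoInfty_vacuum hη.ne']
  split_ifs with h
  · have hfa : ∀ t, f t = ((a * Real.exp (-η * t) : ℝ) : ℂ) := fun t => by
      rw [hf, traceFunctional_apply, wclPredual_vacuum, h, Matrix.trace_fin_two]
      simp [Matrix.mul_apply, Fin.sum_univ_two, mul_comm]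
    simp only [hfa, Complex.ofReal_re]
    refine ⟨Eventually.of_forall fun t => ?_, ?_⟩
    · exact_mod_cast mul_pos ha (Real.exp_pos _)
    · refine (tendsto_log_div_atTop (f := fun t => a * Real.exp (-η * t)) ha
        (C := a) (Eventually.of_forall fun t => ⟨le_rfl, le_rfl⟩)).congr fun t => ?_
      ring
  · have hpp : p = pᴴ * p := by
      rw [show pᴴ = p from hp.isSelfAdjoint, hp.isIdempotentElem.eq]
    -- `p 1 1` is the expectation of `p` in `ρ_∞`, hence the limit of `f`; a positive limit makes
    -- the logarithm bounded.
    have h11 : p 1 1 ≠ 0 := fun h0 => h (hp.eq_of_apply_one_one_eq_zero hp0 h0)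
    have hnn : 0 ≤ p 1 1 := by
      have := (Matrix.posSemidef_conjTranspose_mul_self p).diag_nonneg (i := 1)
      rwa [← hpp] at this
    have hpos : 0 < (p 1 1).re := (Complex.pos_iff.1 (lt_of_le_of_ne hnn h11.symm)).1
    have hlim : Tendsto f atTop (𝓝 (p 1 1)) := by
      have h2 := ((continuous_traceFunctional.tendsto _).comp
        (tendsto_wclPredual_vacuum hη ξ h1))
      have h3 := ((WeakDual.eval_continuous p).tendsto _).comp h2
      rw [rhoInfty_vacuum hη.ne', traceFunctional_apply, Matrix.trace_fin_two] at h3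
      have h4 := h3.congr fun t => (hf t).symm
      simpa [Matrix.mul_apply, Fin.sum_univ_two] using h4
    have hre : Tendsto (fun t => (f t).re) atTop (𝓝 (p 1 1).re) :=
      (Complex.continuous_re.tendsto _).comp hlim
    refine ⟨?_, ?_⟩
    · filter_upwards [hre.eventually_const_lt hpos, eventually_ge_atTop 0] with t ht ht0
      have hs := (traceFunctional_mem_stateSpace (posSemidef_wclPredual_vacuum hη ξ hb ht0)
        ((trace_wclPredual_vacuum _ _ _ _).trans h1)).1 p
      rw [← hpp, ← hf] at hs
      exact Complex.pos_iff.2 ⟨ht, (Complex.nonneg_iff.1 hs).2⟩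
    · have := (hre.log hpos.ne').div_atTop tendsto_id
      refine this.congr fun t => ?_
      rw [id, div_eq_inv_mul, one_div]

open Classical in
theorem mainTheorem8 (η ν ξ : ℝ) (ζ : ℂ) (hη : 0 < η) (hν : 0 ≤ ν)
    (hζ : ‖ζ‖ ^ 2 ≤ ν * (ν + η)) (hν0 : ν = 0)
    (ω : WeakDual ℂ M2) (hω : ω ∈ stateSpace) (hne : ω ≠ traceFunctional (rhoInfty η ν)) :
    ((∀ t : ℝ, 0 ≤ t → ∃ μ : Measure PureState,
        IsOrthogonalMeasure (wclEvolve η ν ξ ζ t ω) μ) ∧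
      ∀ μ : ℝ → Measure PureState,
        (∀ t : ℝ, 0 ≤ t → IsOrthogonalMeasure (wclEvolve η ν ξ ζ t ω) (μ t)) →
          SatisfiesLDP μ (wclRate η ν)) ∧
    ∀ p : M2, IsStarProjection p → p ≠ 0 →
      (∀ᶠ t : ℝ in atTop, 0 < ω (wclSemigroup η ν ξ ζ t p)) ∧
      Tendsto (fun t : ℝ => (1 / t) * Real.log (ω (wclSemigroup η ν ξ ζ t p)).re) atTop
        (𝓝 (if p = 1 - rhoInfty η ν then -η else 0)) := by
  subst hν0
  obtain rfl : ζ = 0 := by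
    rw [zero_mul] at hζ
    exact norm_eq_zero.1 (pow_eq_zero_iff two_ne_zero |>.1 (le_antisymm hζ (by positivity)))
  obtain ⟨ρ, hρ, h1, rfl⟩ := exists_density hω
  obtain ⟨a, b, ha, hb, rfl⟩ :=
    exists_entries_of_ne_rhoInfty hη.ne' hρ h1 fun h => hne (congrArg traceFunctional h)
  simp only [wclEvolve_traceFunctional]
  refine ⟨⟨fun t ht => exists_isOrthogonalMeasure (traceFunctional_mem_stateSpace
    (posSemidef_wclPredual_vacuum hη ξ hb ht) ((trace_wclPredual_vacuum _ _ _ _).trans h1)),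
    fun μ hμ => satisfiesLDP_of_isOrthogonalMeasure hη ξ ha hb hμ⟩, fun p hp hp0 => ?_⟩
  refine tendsto_log_evolve_projection hη ξ ha hb hp hp0 fun t => ?_
  rw [← wclEvolve_apply, wclEvolve_traceFunctional]
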